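/- Let $h \ge 1$ and $d \ge 3$ be integers, let $e_1,\dots,e_d$ be the unit coordinate vectors of $\mathbb{R}^d$ and put $m = e_2+\cdots+e_{d-1}$. Let $$u_1=0,\quad u_2=e_d,\quad u_3=m,\quad u_4=h(m+e_d),\quad u_5=(h-1)m+he_d,\quad u_6=hm+(h-1)e_d,$$ $$u_7=e_1+4e_d,\quad u_8=e_1+5e_d,\quad u_9=e_1+m,\quad u_{10}=e_1+m+e_d,$$ and let $v_i=e_i$, $v_i'=e_i+e_d$ for $2\le i\le d-1$. Let $P_{h,d}\subset\mathbb{R}^d$ be the convex hull of $\{u_1,\dots,u_{10}\}\cup\{v_i,v_i' : 2\le i\le d-1\}$. Let $F_0=P_{h,d}\cap\{x_1=0\}$ and $P_1=\mathrm{conv}(u_7,u_8,u_9,u_{10})$ (which equals $P_{h,d}\cap\{x_1=1\}$). Lemma. (1) Let $n\ge 3$ and $0\le k\le n$ be integers. Every point $\alpha\in nP_{h,d}\cap\mathbb{Z}^d$ whose first coordinate is $k$ can be written as $$\alpha=a^{(1)}+\cdots+a^{(n-k)}+b^{(1)}+\cdots+b^{(k)}$$ with $a^{(s)}\in F_0\cap\mathbb{Z}^d$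 for $1\le s\le n-k$ and $b^{(t)}\in P_1\cap\mathbb{Z}^d$ for $1\le t\le k$. (2) Consequently $P_{h,d}$ is $3$-normal: for every $n\ge 3$, every point of $nP_{h,d}\cap\mathbb{Z}^d$ is a sum of $n$ points of $P_{h,d}\cap\mathbb{Z}^d$. (3) Consequently $P_{h,d}$ has no hole of degree at least $3$. Here, with $A$ the set of points of $\mathbb{Z}^{d+1}$ in the convex hull of $\{(\alpha,1):\alpha\in P_{h,d}\}$, the holes of $P_{h,d}$ are the elements of $(\mathbb{R}_{\ge 0}A\cap\mathbb{Z}A)\setminus\mathbb{Z}_{\ge 0}A$, and the degree of a point of $\mathbb{R}^{d+1}$ is its last coordinate. -/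

import Mathlib

namespace HolePolytope

/-! ### Lattice points, dilations, `k`-normality and holes -/

/-- `x` lies in `ℤ^N`. -/
def IsLatticePoint {N : ℕ} (x : Fin N → ℝ) : Prop :=
  ∀ i, ∃ m : ℤ, x i = m

/-- The dilation `nP = {n α : α ∈ P}`. -/
def dilate {N : ℕ} (n : ℕ) (P : Set (Fin N → ℝ)) : Set (Fin N → ℝ) :=
  (fun x => (n : ℝ) • x) '' P

/-- `P` is `k`-normal: for every `n ≥ k`, every lattice point of `nP` is a sum of `n` lattice points
of `P`. -/
def IsKNormal {N : ℕ} (k : ℕ) (P : Set (Fin N → ℝ)) : Prop :=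
  ∀ n : ℕ, k ≤ n → ∀ α ∈ dilate n P, IsLatticePoint α →
    ∃ a : Fin n → (Fin N → ℝ), (∀ s, a s ∈ P ∧ IsLatticePoint (a s)) ∧ α = ∑ s, a s

/-- The convex hull in `ℝ^(N+1)` of the points `(α, 1)` with `α ∈ P`. -/
def homogenization {N : ℕ} (P : Set (Fin N → ℝ)) : Set (Fin (N + 1) → ℝ) :=
  convexHull ℝ ((fun α : Fin N → ℝ => (Fin.snoc α (1 : ℝ) : Fin (N + 1) → ℝ)) '' P)

/-- The set `A_P` of lattice points of the homogenization. -/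
def latticeGens {N : ℕ} (P : Set (Fin N → ℝ)) : Set (Fin (N + 1) → ℝ) :=
  {x | x ∈ homogenization P ∧ IsLatticePoint x}

/-- The holes of `P`: the elements of `(ℝ≥0 A_P ∩ ℤ A_P) \ ℤ≥0 A_P`. -/
def holes {N : ℕ} (P : Set (Fin N → ℝ)) : Set (Fin (N + 1) → ℝ) :=
  {x | x ∈ Submodule.span NNReal (latticeGens P) ∧
    x ∈ AddSubgroup.closure (latticeGens P) ∧
    x ∉ AddSubmonoid.closure (latticeGens P)}

/-! ### The polytope `P_{h,d}` -/

/-- The unit coordinate vector `e_j` of `ℝ^d`, where the coordinates are numbered `1, …, d`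
(so that `i : Fin d` is the coordinate with number `i + 1`). -/
def eb (d j : ℕ) : Fin d → ℝ := fun i => if (i : ℕ) + 1 = j then 1 else 0

/-- `e_2 + ⋯ + e_{d-1}`. -/
def mid (d : ℕ) : Fin d → ℝ := ∑ j ∈ Finset.Icc 2 (d - 1), eb d j

/-- The points `u_1, …, u_10` (only the indices `1, …, 10` are used). -/
def u (h d : ℕ) : ℕ → (Fin d → ℝ)
  | 1 => 0
  | 2 => eb d d
  | 3 => mid d
  | 4 => (h : ℝ) • (mid d + eb d d)
  | 5 => ((h : ℝ) - 1) • mid d + (h : ℝ) • eb d d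
  | 6 => (h : ℝ) • mid d + ((h : ℝ) - 1) • eb d d
  | 7 => eb d 1 + (4 : ℝ) • eb d d
  | 8 => eb d 1 + (5 : ℝ) • eb d d
  | 9 => eb d 1 + mid d
  | 10 => eb d 1 + mid d + eb d d
  | _ => 0

/-- The points `v_i = e_i`. -/
def v (d i : ℕ) : Fin d → ℝ := eb d i

/-- The points `v_i' = e_i + e_d`. -/
def v' (d i : ℕ) : Fin d → ℝ := eb d i + eb d d

/-- The polytope `P_{h,d}`: the convex hull of `u_1, …, u_10` and of `v_i, v_i'` for
`2 ≤ i ≤ d - 1`. -/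
def poly (h d : ℕ) : Set (Fin d → ℝ) :=
  convexHull ℝ
    (u h d '' Set.Icc 1 10 ∪ (v d '' Set.Icc 2 (d - 1) ∪ v' d '' Set.Icc 2 (d - 1)))

/-- `P_{h,d}(n,k)`: the points of `n P_{h,d}` whose first coordinate is `k`. -/
def slice (h d n k : ℕ) : Set (Fin d → ℝ) :=
  {x | x ∈ dilate n (poly h d) ∧ ∀ i : Fin d, (i : ℕ) = 0 → x i = (k : ℝ)}

/-- The facet `F_0 = P_{h,d} ∩ {x_1 = 0}`. -/
def F0 (h d : ℕ) : Set (Fin d → ℝ) :=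
  {x | x ∈ poly h d ∧ ∀ i : Fin d, (i : ℕ) = 0 → x i = 0}

/-- `P_1 = conv(u_7, u_8, u_9, u_10)`. -/
def P1 (h d : ℕ) : Set (Fin d → ℝ) :=
  convexHull ℝ {u h d 7, u h d 8, u h d 9, u h d 10}

end HolePolytope

/-! Write a point of `nP` with first coordinate `k` as a weighted sum of vertices. Those of `P_1`
carry weight `k`; the other weight `N = n - k` splits into `s` on the `v_i, v_i'` and `M = N - s` on
the strip of points `p m + q e_d` with `0 ≤ p, q ≤ h` and `|p - q| ≤ 1`. If the `P_1` part
contributes `t m` and the strip part `p m + q e_d`, then `m` has total coefficient `c = t + p` and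
the last coordinate is `4 (k - t) + σ + τ + q` with `0 ≤ σ ≤ k`, `0 ≤ τ ≤ s`. Eliminating `p, q, σ,
τ` leaves the linear system `SliceBound`, which only has to be checked at the vertices.

For a lattice point, `c` can be raised to the least middle coordinate, an integer; then only `t` has
to be rounded. This is `exists_int_of_bounds`, where `n ≥ 3` enters. With integral parameters each
part splits into lattice points separately (`exists_sum_facet`, `exists_sum_top`).

For the holes: a lattice point of degree `n ≥ 3` in the cone is a lattice point of `nP` at height
`n`, hence a sum of `n` generators. -/

namespace HolePolytope

open Finset
open scoped Pointwise

/-! ### Coordinates -/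

section Coordinates

variable {D : ℕ}

/-- The middle coordinates of a vector of `ℝ^(D+2)`. -/
def midCoord (x : Fin (D + 2) → ℝ) (i : Fin D) : ℝ := x i.castSucc.succ

theorem ext_coord {x y : Fin (D + 2) → ℝ} (h0 : x 0 = y 0)
    (hm : ∀ i, midCoord x i = midCoord y i) (hl : x (Fin.last _) = y (Fin.last _)) : x = y := by
  funext j
  refine Fin.cases h0 (fun j => ?_) j
  refine Fin.lastCases ?_ (fun i => hm i) j
  simpa using hl

@[simp] theorem midCoord_zero (i : Fin D) : midCoord (0 : Fin (D + 2) → ℝ) i = 0 := rfl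

@[simp] theorem midCoord_add (x y : Fin (D + 2) → ℝ) (i : Fin D) :
    midCoord (x + y) i = midCoord x i + midCoord y i := rfl

@[simp] theorem midCoord_smul (r : ℝ) (x : Fin (D + 2) → ℝ) (i : Fin D) :
    midCoord (r • x) i = r * midCoord x i := rfl

@[simp] theorem midCoord_sum {ι : Type*} (s : Finset ι) (f : ι → Fin (D + 2) → ℝ) (i : Fin D) :
    midCoord (∑ j ∈ s, f j) i = ∑ j ∈ s, midCoord (f j) i := by
  simp [midCoord]

@[simp] theorem eb_one_zero : eb (D + 2) 1 0 = 1 := by simp [eb]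

@[simp] theorem eb_one_last : eb (D + 2) 1 (Fin.last _) = 0 := by simp [eb]

@[simp] theorem midCoord_eb_one (i : Fin D) : midCoord (eb (D + 2) 1) i = 0 := by
  simp [eb, midCoord]

@[simp] theorem eb_self_zero : eb (D + 2) (D + 2) 0 = 0 := by simp [eb]

@[simp] theorem eb_self_last : eb (D + 2) (D + 2) (Fin.last _) = 1 := by simp [eb]

@[simp] theorem midCoord_eb_self (i : Fin D) : midCoord (eb (D + 2) (D + 2)) i = 0 := by
  have := i.2
  simp [eb, midCoord]
  omega

@[simp] theorem eb_mid_zero (j : Fin D) : eb (D + 2) (j + 2) 0 = 0 := by simp [eb]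

@[simp] theorem eb_mid_last (j : Fin D) : eb (D + 2) (j + 2) (Fin.last _) = 0 := by
  have := j.2
  simp [eb]
  omega

@[simp] theorem midCoord_eb_mid (i j : Fin D) :
    midCoord (eb (D + 2) (j + 2)) i = if j = i then 1 else 0 := by
  simp [eb, midCoord, Fin.ext_iff, eq_comm]

@[simp] theorem mid_zero : mid (D + 2) 0 = 0 := by simp [mid, eb]

@[simp] theorem mid_last : mid (D + 2) (Fin.last _) = 0 := by simp [mid, eb]

@[simp] theorem midCoord_mid (i : Fin D) : midCoord (mid (D + 2)) i = 1 := by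
  simp [mid, eb, midCoord]

end Coordinates

/-! ### Inequalities valid on the slices -/

/-- A system of linear inequalities, in two auxiliary real variables `t` and `c`, that every point
of `n P_{h,d}` satisfies. -/
def SliceBound (h D : ℕ) (n : ℝ) (x : Fin (D + 2) → ℝ) : Prop :=
  -- Here `∑ midCoord - D * c` is the weight `s` on the `v_i, v_i'`. The last four inequalities say
  -- that the lower bounds `0`, `p - M`, `w - k - s` for `q` are compatible with its upper bounds
  -- `w`, `h M`, `p + M`, where `w = z - 4 (k - t)`, `z` is the last coordinate and `p = c - t`.
  ∃ t c : ℝ, (∀ i, c ≤ midCoord x i) ∧ 0 ≤ t ∧ t ≤ x 0 ∧ t ≤ c ∧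
    c - h * (n - x 0 - (∑ i, midCoord x i - D * c)) ≤ t ∧
    4 * x 0 - x (Fin.last _) ≤ 4 * t ∧
    c + (∑ i, midCoord x i - D * c) - (n - x 0) - x (Fin.last _) + 4 * x 0 ≤ 5 * t ∧
    4 * t ≤ 5 * x 0 - x (Fin.last _) + h * (n - x 0 - (∑ i, midCoord x i - D * c))
      + (∑ i, midCoord x i - D * c) ∧
    5 * t ≤ c + (n - x 0) + 5 * x 0 - x (Fin.last _)

/-- The system is homogeneous and linear in `(n, x, t, c)` jointly, so witnesses add; with scaling
this gives convexity. -/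
theorem SliceBound.add {h D : ℕ} {n n' : ℝ} {x y : Fin (D + 2) → ℝ}
    (hx : SliceBound h D n x) (hy : SliceBound h D n' y) : SliceBound h D (n + n') (x + y) := by
  obtain ⟨t, c, h0, h1, h2, h3, h4, h5, h6, h7, h8⟩ := hx
  obtain ⟨t', c', h0', h1', h2', h3', h4', h5', h6', h7', h8'⟩ := hy
  refine ⟨t + t', c + c', fun i => ?_, ?_⟩
  · simpa using add_le_add (h0 i) (h0' i)
  · simp only [midCoord_add, Pi.add_apply, Finset.sum_add_distrib]
    refine ⟨?_, ?_, ?_, ?_, ?_, ?_, ?_, ?_⟩ <;> linarith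

theorem SliceBound.smul {h D : ℕ} {n : ℝ} {x : Fin (D + 2) → ℝ} (hx : SliceBound h D n x)
    {r : ℝ} (hr : 0 ≤ r) : SliceBound h D (r * n) (r • x) := by
  obtain ⟨t, c, h0, h1, h2, h3, h4, h5, h6, h7, h8⟩ := hx
  refine ⟨r * t, r * c, fun i => ?_, ?_⟩
  · simpa using mul_le_mul_of_nonneg_left (h0 i) hr
  · simp only [midCoord_smul, Pi.smul_apply, smul_eq_mul, ← Finset.mul_sum]
    have k1 := mul_le_mul_of_nonneg_left h1 hr
    have k2 := mul_le_mul_of_nonneg_left h2 hr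
    have k3 := mul_le_mul_of_nonneg_left h3 hr
    have k4 := mul_le_mul_of_nonneg_left h4 hr
    have k5 := mul_le_mul_of_nonneg_left h5 hr
    have k6 := mul_le_mul_of_nonneg_left h6 hr
    have k7 := mul_le_mul_of_nonneg_left h7 hr
    have k8 := mul_le_mul_of_nonneg_left h8 hr
    refine ⟨?_, ?_, ?_, ?_, ?_, ?_, ?_, ?_⟩ <;> linarith

theorem convex_sliceBound (h D : ℕ) : Convex ℝ {x | SliceBound h D 1 x} := by
  intro x hx y hy a b ha hb hab
  have := (SliceBound.smul hx ha).add (SliceBound.smul hy hb)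
  rwa [mul_one, mul_one, hab] at this

theorem SliceBound.of_facet_strip {h D : ℕ} {x : Fin (D + 2) → ℝ} {p q : ℝ} (h0 : x 0 = 0)
    (hm : ∀ i, midCoord x i = p) (hl : x (Fin.last _) = q) (hp : 0 ≤ p) (hph : p ≤ h)
    (hq : 0 ≤ q) (hqh : q ≤ h) (hpq : p ≤ q + 1) (hqp : q ≤ p + 1) : SliceBound h D 1 x := by
  refine ⟨0, p, fun i => (hm i).ge, ?_⟩
  simp only [hm, h0, hl, Finset.sum_const, Finset.card_univ, Fintype.card_fin, nsmul_eq_mul]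
  refine ⟨?_, ?_, ?_, ?_, ?_, ?_, ?_, ?_⟩ <;> linarith

theorem SliceBound.of_facet_prism {h D : ℕ} {x : Fin (D + 2) → ℝ} {q : ℝ} (j : Fin D)
    (h0 : x 0 = 0) (hm : ∀ i, midCoord x i = if j = i then 1 else 0)
    (hl : x (Fin.last _) = q) (hq : 0 ≤ q) (hq1 : q ≤ 1) : SliceBound h D 1 x := by
  refine ⟨0, 0, fun i => ?_, ?_⟩
  · rw [hm]; split_ifs <;> norm_num
  · simp only [hm, h0, hl, Finset.sum_ite_eq, Finset.mem_univ, if_true]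
    refine ⟨?_, ?_, ?_, ?_, ?_, ?_, ?_, ?_⟩ <;> linarith

theorem SliceBound.of_top {h D : ℕ} {x : Fin (D + 2) → ℝ} {p q : ℝ} (h0 : x 0 = 1)
    (hm : ∀ i, midCoord x i = p) (hl : x (Fin.last _) = 4 * (1 - p) + q)
    (hp : 0 ≤ p) (hp1 : p ≤ 1) (hq : 0 ≤ q) (hq1 : q ≤ 1) : SliceBound h D 1 x := by
  refine ⟨p, p, fun i => (hm i).ge, ?_⟩
  simp only [hm, h0, hl, Finset.sum_const, Finset.card_univ, Fintype.card_fin, nsmul_eq_mul]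
  refine ⟨?_, ?_, ?_, ?_, ?_, ?_, ?_, ?_⟩ <;> linarith

theorem sliceBound_of_mem_poly {h D : ℕ} (hh : 1 ≤ h) {x : Fin (D + 2) → ℝ}
    (hx : x ∈ poly h (D + 2)) : SliceBound h D 1 x := by
  have hh' : (1 : ℝ) ≤ h := by exact_mod_cast hh
  refine convexHull_min ?_ (convex_sliceBound h D) hx
  rintro _ (⟨i, hi, rfl⟩ | ⟨i, hi, rfl⟩ | ⟨i, hi, rfl⟩)
  · obtain ⟨h1, h10⟩ := hi
    interval_cases i
    · apply SliceBound.of_facet_strip (p := 0) (q := 0) <;> simp [u]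
    · apply SliceBound.of_facet_strip (p := 0) (q := 1) <;> simp [u, hh]
    · apply SliceBound.of_facet_strip (p := 1) (q := 0) <;> simp [u, hh]
    · apply SliceBound.of_facet_strip (p := h) (q := h) <;> simp [u]
    · apply SliceBound.of_facet_strip (p := h - 1) (q := h) <;> simp [u, hh]; linarith
    · apply SliceBound.of_facet_strip (p := h) (q := h - 1) <;> simp [u, hh]; linarith
    · apply SliceBound.of_top (p := 0) (q := 0) <;> simp [u]
    · apply SliceBound.of_top (p := 0) (q := 1) <;> simp [u]; norm_num
    · apply SliceBound.of_top (p := 1) (q := 0) <;> simp [u]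
    · apply SliceBound.of_top (p := 1) (q := 1) <;> simp [u]
  · obtain ⟨h2, hd⟩ := hi
    obtain ⟨j, rfl⟩ : ∃ j : Fin D, i = j + 2 := ⟨⟨i - 2, by omega⟩, by simp; omega⟩
    apply SliceBound.of_facet_prism (q := 0) j <;> simp [v]
  · obtain ⟨h2, hd⟩ := hi
    obtain ⟨j, rfl⟩ : ∃ j : Fin D, i = j + 2 := ⟨⟨i - 2, by omega⟩, by simp; omega⟩
    apply SliceBound.of_facet_prism (q := 1) j <;> simp [v']

theorem sliceBound_of_mem_dilate {h D n : ℕ} (hh : 1 ≤ h) {x : Fin (D + 2) → ℝ}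
    (hx : x ∈ dilate n (poly h (D + 2))) : SliceBound h D n x := by
  obtain ⟨y, hy, rfl⟩ := hx
  simpa using (sliceBound_of_mem_poly hh hy).smul n.cast_nonneg

/-! ### From real to integral parameters -/

/-- The least integer above all lower bounds works. Rounding costs at most 3 in a bound on `4 t` and
4 in one on `5 t`. The gap `k + G + s ≥ N + k ≥ 3` absorbs the former. The gap `2 N - s + k` absorbs
the latter if `s < N`; if `s = N` then `G = 0` forces `t = c`, already integral. -/
theorem exists_int_of_bounds {G N k c s z : ℤ} (hn : 3 ≤ N + k) (hGN : N - s ≤ G)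
    (hsN : s ≤ N) (hG : N = s → G = 0) {t : ℝ} (h1 : 0 ≤ t)
    (h2 : t ≤ k) (h3 : t ≤ c) (h4 : c - G ≤ t) (h5 : 4 * k - z ≤ 4 * t)
    (h6 : c + s - N - z + 4 * k ≤ 5 * t) (h7 : 4 * t ≤ 5 * k - z + G + s)
    (h8 : 5 * t ≤ c + N + 5 * k - z) :
    ∃ t : ℤ, 0 ≤ t ∧ t ≤ k ∧ t ≤ c ∧ c - G ≤ t ∧ 4 * k - z ≤ 4 * t ∧
      c + s - N - z + 4 * k ≤ 5 * t ∧ 4 * t ≤ 5 * k - z + G + s ∧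
      5 * t ≤ c + N + 5 * k - z := by
  -- Eliminating the real `t` between a lower and an upper bound, at least one of them integral,
  -- gives integer inequalities.
  have a1 : 0 ≤ k := by exact_mod_cast h1.trans h2
  have a2 : 0 ≤ c := by exact_mod_cast h1.trans h3
  have a3 : 0 ≤ 5 * k - z + G + s := by exact_mod_cast (by linarith : (0:ℝ) ≤ 5 * k - z + G + s)
  have a4 : 0 ≤ c + N + 5 * k - z := by exact_mod_cast (by linarith : (0:ℝ) ≤ c + N + 5 * k - z)
  have b1 : c - G ≤ k := by exact_mod_cast h4.trans h2
  have b2 : c - G ≤ c := by exact_mod_cast h4.trans h3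
  have b3 : 4 * (c - G) ≤ 5 * k - z + G + s := by
    exact_mod_cast (by linarith : (4 * (c - G) : ℝ) ≤ 5 * k - z + G + s)
  have b4 : 5 * (c - G) ≤ c + N + 5 * k - z := by
    exact_mod_cast (by linarith : (5 * (c - G) : ℝ) ≤ c + N + 5 * k - z)
  have c1 : 4 * k - z ≤ 4 * k := by exact_mod_cast (by linarith : (4 * k - z : ℝ) ≤ 4 * k)
  have c2 : 4 * k - z ≤ 4 * c := by exact_mod_cast (by linarith : (4 * k - z : ℝ) ≤ 4 * c)
  have d1 : c + s - N - z + 4 * k ≤ 5 * k := by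
    exact_mod_cast (by linarith : (c + s - N - z + 4 * k : ℝ) ≤ 5 * k)
  have d2 : c + s - N - z + 4 * k ≤ 5 * c := by
    exact_mod_cast (by linarith : (c + s - N - z + 4 * k : ℝ) ≤ 5 * c)
  have hlow : ∃ t : ℤ, (0 ≤ t ∧ c - G ≤ t ∧ 4 * k - z ≤ 4 * t ∧
      c + s - N - z + 4 * k ≤ 5 * t) ∧ (t = 0 ∨ t = c - G ∨ 4 * t ≤ 4 * k - z + 3 ∨
      5 * t ≤ c + s - N - z + 4 * k + 4) ∧ t ≤ k ∧ t ≤ c :=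
    -- Integer division rounds down, so the negated quotients are ceilings.
    ⟨max (max 0 (c - G)) (max (-((z - 4 * k) / 4)) (-((z + N - c - s - 4 * k) / 5))),
      by omega, by omega, by omega, by omega⟩
  obtain ⟨t, ⟨l1, l2, l3, l4⟩, l5, l6, l7⟩ := hlow
  refine ⟨t, l1, l6, l7, l2, l3, l4, ?_, ?_⟩ <;> omega

theorem exists_decomposition_parameters {G : ℤ} {M k s : ℕ} {c z : ℤ} (hn : 3 ≤ s + M + k)
    (hGM : M ≤ G) (hG : M = 0 → G = 0) {t : ℝ} (h1 : 0 ≤ t)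
    (h2 : t ≤ k) (h3 : t ≤ c) (h4 : c - G ≤ t) (h5 : 4 * k - z ≤ 4 * t)
    (h6 : c - M - z + 4 * k ≤ 5 * t) (h7 : 4 * t ≤ 5 * k - z + G + s)
    (h8 : 5 * t ≤ c + s + M + 5 * k - z) :
    ∃ l p q σ τ : ℕ, l ≤ k ∧ σ ≤ k ∧ τ ≤ s ∧ p ≤ G ∧ q ≤ G ∧ p ≤ q + M ∧ q ≤ p + M ∧
      c = l + p ∧ z = 4 * (k - l) + σ + τ + q := by
  obtain ⟨l, l1, l2, l3, l4, l5, l6, l7, l8⟩ :=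
    exists_int_of_bounds (G := G) (N := s + M) (k := k) (c := c) (s := s) (z := z) (t := t)
      (by omega) (by omega) (by omega) (by omega) h1 (by exact_mod_cast h2) h3 h4
      (by exact_mod_cast h5) (by push_cast; linarith) (by push_cast; linarith)
      (by push_cast; linarith)
  obtain ⟨q, q1, q2, q3, q4, q5, q6⟩ : ∃ q : ℤ, 0 ≤ q ∧ q ≤ G ∧ c - l ≤ q + M ∧
      q ≤ c - l + M ∧ q ≤ z - 4 * (k - l) ∧ z - 4 * (k - l) ≤ q + k + s :=
    -- The least admissible `q`; the remainder of `z` is then given to `σ` up to `k`, and the rest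
    -- to `τ`.
    ⟨max (max 0 (c - l - M)) (z - 4 * (k - l) - k - s), by omega, by omega, by omega, by omega,
      by omega, by omega⟩
  exact ⟨l.toNat, (c - l).toNat, q.toNat, (min (z - 4 * (k - l) - q) k).toNat,
    (z - 4 * (k - l) - q - min (z - 4 * (k - l) - q) k).toNat, by omega, by omega, by omega,
    by omega, by omega, by omega, by omega, by omega, by omega⟩

/-! ### Elementary decompositions -/

theorem sum_ite_val_lt {n b : ℕ} (hb : b ≤ n) :
    ∑ j : Fin n, (if (j : ℕ) < b then (1 : ℝ) else 0) = b := by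
  rw [Fin.sum_univ_eq_sum_range (fun j => if j < b then (1 : ℝ) else 0) n, Finset.sum_boole]
  congr 1
  rw [show (range n).filter (· < b) = range b by ext; simp; omega, card_range]

/-- Hermite's identity: passing from `c` to `c + 1` shifts the window, replacing `c / M` by `c / M +
1`. -/
theorem sum_range_add_div (M c : ℕ) (hM : 0 < M) : ∑ j ∈ range M, (c + j) / M = c := by
  induction c with
  | zero => exact Finset.sum_eq_zero fun j hj => by simpa using Or.inr (mem_range.1 hj)
  | succ c ih =>
    have h1 := Finset.sum_range_succ (fun j => (c + j) / M) M
    have h2 := Finset.sum_range_succ' (fun j => (c + j) / M) M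
    rw [ih, Nat.add_div_right _ hM] at h1
    simp only [add_zero] at h2
    have h3 : ∑ j ∈ range M, (c + 1 + j) / M = ∑ j ∈ range M, (c + (j + 1)) / M :=
      Finset.sum_congr rfl fun j _ => by rw [add_right_comm, add_assoc]
    omega

/-- Lattice points of the `M`-fold dilation of the strip `{0 ≤ p, q ≤ h, |p - q| ≤ 1}` are sums of
`M` lattice points of the strip. -/
theorem exists_strip_decomposition {h M p q : ℕ} (hp : p ≤ h * M) (hq : q ≤ h * M)
    (hpq : p ≤ q + M) (hqp : q ≤ p + M) :
    ∃ P Q : Fin M → ℕ, (∀ j, P j ≤ h ∧ Q j ≤ h ∧ P j ≤ Q j + 1 ∧ Q j ≤ P j + 1) ∧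
      ∑ j, P j = p ∧ ∑ j, Q j = q := by
  rcases Nat.eq_zero_or_pos M with rfl | hM
  · exact ⟨fun _ => 0, fun _ => 0, fun j => j.elim0, by simp; omega, by simp; omega⟩
  have le_h : ∀ (c : ℕ) (j : Fin M), c ≤ h * M → (c + j) / M ≤ h := fun c j hc => by
    have := j.2
    rw [← Nat.lt_succ_iff, Nat.div_lt_iff_lt_mul hM, Nat.succ_mul]
    omega
  have le_succ : ∀ (c c' : ℕ) (j : Fin M), c ≤ c' + M → (c + j) / M ≤ (c' + j) / M + 1 :=
    fun c c' j hc => by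
      rw [← Nat.add_div_right _ hM]
      exact Nat.div_le_div_right (by omega)
  -- Using the same shift `j` for both balanced splittings keeps their entries within 1 of each
  -- other.
  refine ⟨fun j => (p + j) / M, fun j => (q + j) / M,
    fun j => ⟨le_h _ _ hp, le_h _ _ hq, le_succ _ _ _ hpq, le_succ _ _ _ hqp⟩, ?_, ?_⟩
  · rw [Fin.sum_univ_eq_sum_range (fun j => (p + j) / M), sum_range_add_div _ _ hM]
  · rw [Fin.sum_univ_eq_sum_range (fun j => (q + j) / M), sum_range_add_div _ _ hM]

theorem exists_sum_indicator {D : ℕ} (a : Fin D → ℕ) :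
    ∃ f : Fin (∑ i, a i) → Fin D, ∀ i, ∑ j, (if f j = i then (1 : ℝ) else 0) = a i := by
  refine ⟨fun j => (finSigmaFinEquiv.symm j).1, fun i => ?_⟩
  rw [Equiv.sum_comp finSigmaFinEquiv.symm (fun x => if x.1 = i then (1 : ℝ) else 0),
    Fintype.sum_sigma, Fintype.sum_eq_single i fun j hj => by simp [hj]]
  simp

/-! ### Lattice points of the two facets -/

theorem isLatticePoint_zero {N : ℕ} : IsLatticePoint (0 : Fin N → ℝ) := fun _ => ⟨0, by simp⟩

theorem IsLatticePoint.add {N : ℕ} {x y : Fin N → ℝ} (hx : IsLatticePoint x)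
    (hy : IsLatticePoint y) : IsLatticePoint (x + y) := fun i => by
  obtain ⟨m, hm⟩ := hx i
  obtain ⟨m', hm'⟩ := hy i
  exact ⟨m + m', by simp [hm, hm']⟩

theorem IsLatticePoint.neg {N : ℕ} {x : Fin N → ℝ} (hx : IsLatticePoint x) :
    IsLatticePoint (-x) := fun i => by
  obtain ⟨m, hm⟩ := hx i
  exact ⟨-m, by simp [hm]⟩

theorem IsLatticePoint.natCast_smul {N : ℕ} {x : Fin N → ℝ} (hx : IsLatticePoint x) (n : ℕ) :
    IsLatticePoint ((n : ℝ) • x) := fun i => by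
  obtain ⟨m, hm⟩ := hx i
  exact ⟨n * m, by simp [hm]⟩

theorem isLatticePoint_eb (d j : ℕ) : IsLatticePoint (eb d j) := fun i =>
  ⟨if (i : ℕ) + 1 = j then 1 else 0, by simp [eb]⟩

theorem isLatticePoint_mid (d : ℕ) : IsLatticePoint (mid d) := fun i =>
  ⟨∑ j ∈ Finset.Icc 2 (d - 1), if (i : ℕ) + 1 = j then 1 else 0, by simp [mid, eb]⟩

theorem u_mem_poly {h d i : ℕ} (h1 : 1 ≤ i) (h10 : i ≤ 10) : u h d i ∈ poly h d :=
  subset_convexHull ℝ _ (Or.inl ⟨i, ⟨h1, h10⟩, rfl⟩)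

theorem convex_poly (h d : ℕ) : Convex ℝ (poly h d) := convex_convexHull ℝ _

theorem _root_.Convex.add_natCast_smul_mem {E : Type*} [AddCommGroup E] [Module ℝ E] {S : Set E}
    (hS : Convex ℝ S) {x w : E} {p K : ℕ} (hpK : p ≤ K) (hx : x ∈ S)
    (hK : x + (K : ℝ) • w ∈ S) : x + (p : ℝ) • w ∈ S := by
  rcases Nat.eq_zero_or_pos K with rfl | h
  · obtain rfl : p = 0 := by omega
    exact hK
  have hK0 : (0 : ℝ) < K := by exact_mod_cast h
  have := hS.add_smul_mem hx hK (t := (p : ℝ) / K)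
    ⟨by positivity, (div_le_one hK0).2 (by exact_mod_cast hpK)⟩
  rwa [smul_smul, div_mul_cancel₀ _ hK0.ne'] at this

theorem strip_mem_poly {h d p q : ℕ} (hh : 1 ≤ h) (hp : p ≤ h) (hq : q ≤ h) (hpq : p ≤ q + 1)
    (hqp : q ≤ p + 1) : (p : ℝ) • mid d + (q : ℝ) • eb d d ∈ poly h d := by
  have hc : ((h - 1 : ℕ) : ℝ) = h - 1 := by push_cast [hh]; rfl
  -- The lattice points of the strip lie on three parallel segments: `u_1 u_4`, `u_3 u_6`, `u_2
  -- u_5`.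
  rcases (by omega : p = q ∨ p = q + 1 ∨ q = p + 1) with rfl | rfl | rfl
  · rw [← smul_add, ← zero_add ((p : ℝ) • _)]
    refine (convex_poly h d).add_natCast_smul_mem hp (u_mem_poly (i := 1) (by simp) (by simp)) ?_
    rw [zero_add]
    exact u_mem_poly (i := 4) (by simp) (by simp)
  · have := (convex_poly h d).add_natCast_smul_mem (w := mid d + eb d d)
      (show q ≤ h - 1 by omega) (u_mem_poly (i := 3) (by simp) (by simp)) (by
        convert u_mem_poly (h := h) (d := d) (i := 6) (by simp) (by simp) using 1
        simp only [u, hc]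
        module)
    convert this using 1
    simp only [u]
    push_cast
    module
  · have := (convex_poly h d).add_natCast_smul_mem (w := mid d + eb d d)
      (show p ≤ h - 1 by omega) (u_mem_poly (i := 2) (by simp) (by simp)) (by
        convert u_mem_poly (h := h) (d := d) (i := 5) (by simp) (by simp) using 1
        simp only [u, hc]
        module)
    convert this using 1
    simp only [u]
    push_cast
    module

theorem strip_mem_F0 {h D p q : ℕ} (hh : 1 ≤ h) (hp : p ≤ h) (hq : q ≤ h) (hpq : p ≤ q + 1)
    (hqp : q ≤ p + 1) :
    (p : ℝ) • mid (D + 2) + (q : ℝ) • eb (D + 2) (D + 2) ∈ F0 h (D + 2) := by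
  refine ⟨strip_mem_poly hh hp hq hpq hqp, fun i hi => ?_⟩
  obtain rfl : i = 0 := Fin.ext hi
  simp

theorem prism_mem_F0 {h D : ℕ} (j : Fin D) (P : Prop) [Decidable P] :
    eb (D + 2) (j + 2) + (if P then (1 : ℝ) else 0) • eb (D + 2) (D + 2) ∈ F0 h (D + 2) := by
  have := j.2
  refine ⟨?_, fun i hi => ?_⟩
  · split_ifs
    · rw [one_smul]
      exact subset_convexHull ℝ _ (Or.inr (Or.inr ⟨j + 2, ⟨by omega, by omega⟩, rfl⟩))
    · rw [zero_smul, add_zero]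
      exact subset_convexHull ℝ _ (Or.inr (Or.inl ⟨j + 2, ⟨by omega, by omega⟩, rfl⟩))
  · obtain rfl : i = 0 := Fin.ext hi
    split_ifs <;> simp

/-- The four lattice points of `P_1`, indexed by two truth values. -/
theorem top_mem_P1 {h d : ℕ} (P Q : Prop) [Decidable P] [Decidable Q] :
    eb d 1 + (if P then (1 : ℝ) else 0) • mid d
      + (4 * (1 - if P then (1 : ℝ) else 0) + if Q then (1 : ℝ) else 0) • eb d d ∈ P1 h d := by
  refine subset_convexHull ℝ _ ?_
  split_ifs
  · right; right; right; simp [u]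
  · right; right; left; simp [u]
  · right; left; norm_num [u]
  · left; simp [u]

theorem isLatticePoint_ite_smul {N : ℕ} {x : Fin N → ℝ} (hx : IsLatticePoint x) (P : Prop)
    [Decidable P] : IsLatticePoint ((if P then (1 : ℝ) else 0) • x) := by
  split_ifs <;> simp [hx, isLatticePoint_zero]

theorem isLatticePoint_top {d : ℕ} (P Q : Prop) [Decidable P] [Decidable Q] :
    IsLatticePoint (eb d 1 + (if P then (1 : ℝ) else 0) • mid d
      + (4 * (1 - if P then (1 : ℝ) else 0) + if Q then (1 : ℝ) else 0) • eb d d) := by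
  refine ((isLatticePoint_eb _ _).add (isLatticePoint_ite_smul (isLatticePoint_mid _) _)).add ?_
  convert (isLatticePoint_eb d d).natCast_smul
    (4 * (1 - if P then 1 else 0) + if Q then 1 else 0) using 2
  split_ifs <;> norm_num

/-! ### Sums of lattice points of the two facets -/

theorem exists_sum_facet {h D M p q τ : ℕ} (hh : 1 ≤ h) (a : Fin D → ℕ) (hτ : τ ≤ ∑ i, a i)
    (hp : p ≤ h * M) (hq : q ≤ h * M) (hpq : p ≤ q + M) (hqp : q ≤ p + M) :
    ∃ f : Fin (∑ i, a i + M) → (Fin (D + 2) → ℝ),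
      (∀ j, f j ∈ F0 h (D + 2) ∧ IsLatticePoint (f j)) ∧ (∑ j, f j) 0 = 0 ∧
      (∀ i, midCoord (∑ j, f j) i = a i + p) ∧ (∑ j, f j) (Fin.last _) = τ + q := by
  obtain ⟨g, hg⟩ := exists_sum_indicator a
  obtain ⟨P, Q, hPQ, rfl, rfl⟩ := exists_strip_decomposition hp hq hpq hqp
  refine ⟨Fin.append
    (fun j => eb (D + 2) (g j + 2) + (if (j : ℕ) < τ then (1 : ℝ) else 0) • eb (D + 2) (D + 2))
    (fun j => (P j : ℝ) • mid (D + 2) + (Q j : ℝ) • eb (D + 2) (D + 2)),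
    fun j => ?_, ?_, fun i => ?_, ?_⟩
  · refine Fin.addCases (fun j => ?_) (fun j => ?_) j
    · rw [Fin.append_left]
      exact ⟨prism_mem_F0 _ _,
        (isLatticePoint_eb _ _).add (isLatticePoint_ite_smul (isLatticePoint_eb _ _) _)⟩
    · rw [Fin.append_right]
      obtain ⟨h1, h2, h3, h4⟩ := hPQ j
      exact ⟨strip_mem_F0 hh h1 h2 h3 h4, ((isLatticePoint_mid _).natCast_smul _).add
        ((isLatticePoint_eb _ _).natCast_smul _)⟩
  · simp only [Fin.sum_univ_add, Fin.append_left, Fin.append_right, Pi.add_apply,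
      Finset.sum_apply, Pi.smul_apply, smul_eq_mul, eb_mid_zero, eb_self_zero, mid_zero]
    simp
  · simp only [Fin.sum_univ_add, Fin.append_left, Fin.append_right, midCoord_add, midCoord_sum,
      midCoord_smul, midCoord_eb_mid, midCoord_eb_self, midCoord_mid, mul_zero, mul_one, add_zero,
      hg]
    push_cast
    rfl
  · simp only [Fin.sum_univ_add, Fin.append_left, Fin.append_right, Pi.add_apply,
      Finset.sum_apply, Pi.smul_apply, smul_eq_mul, eb_mid_last, eb_self_last, mid_last, mul_zero,
      mul_one, zero_add, sum_ite_val_lt hτ]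
    push_cast
    rfl

theorem exists_sum_top (h : ℕ) {D k l σ : ℕ} (hl : l ≤ k) (hσ : σ ≤ k) :
    ∃ f : Fin k → (Fin (D + 2) → ℝ),
      (∀ j, f j ∈ P1 h (D + 2) ∧ IsLatticePoint (f j)) ∧ (∑ j, f j) 0 = k ∧
      (∀ i, midCoord (∑ j, f j) i = l) ∧ (∑ j, f j) (Fin.last _) = 4 * (k - l) + σ := by
  refine ⟨fun j => eb (D + 2) 1 + (if (j : ℕ) < l then (1 : ℝ) else 0) • mid (D + 2)
      + (4 * (1 - if (j : ℕ) < l then (1 : ℝ) else 0) + if (j : ℕ) < σ then (1 : ℝ) else 0)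
        • eb (D + 2) (D + 2),
    fun j => ⟨top_mem_P1 _ _, isLatticePoint_top _ _⟩, ?_, fun i => ?_, ?_⟩
  · simp only [Finset.sum_apply, Pi.add_apply, Pi.smul_apply, smul_eq_mul, eb_one_zero, mid_zero,
      eb_self_zero, mul_zero, add_zero]
    simp
  · simp only [midCoord_sum, midCoord_add, midCoord_smul, midCoord_eb_one, midCoord_mid,
      midCoord_eb_self, mul_zero, mul_one, zero_add, add_zero, sum_ite_val_lt hl]
  · simp only [Finset.sum_apply, Pi.add_apply, Pi.smul_apply, smul_eq_mul, eb_one_last, mid_last,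
      eb_self_last, mul_zero, mul_one, zero_add, Finset.sum_add_distrib, ← Finset.mul_sum,
      Finset.sum_sub_distrib, sum_ite_val_lt hl, sum_ite_val_lt hσ]
    simp

/-! ### Decomposition of the lattice points of a slice -/

theorem exists_slice_decomposition {h D N k : ℕ} (hh : 1 ≤ h) (hD : 1 ≤ D) (hn : 3 ≤ N + k)
    {x : Fin (D + 2) → ℝ} (hx : SliceBound h D ((N + k : ℕ) : ℝ) x) (hx0 : x 0 = k)
    (hlat : IsLatticePoint x) :
    ∃ (a : Fin N → (Fin (D + 2) → ℝ)) (b : Fin k → (Fin (D + 2) → ℝ)),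
      (∀ s, a s ∈ F0 h (D + 2) ∧ IsLatticePoint (a s)) ∧
      (∀ t, b t ∈ P1 h (D + 2) ∧ IsLatticePoint (b t)) ∧ x = (∑ s, a s) + ∑ t, b t := by
  have : Nonempty (Fin D) := ⟨⟨0, hD⟩⟩
  choose y hy using fun i : Fin D => hlat i.castSucc.succ
  change ∀ i, midCoord x i = y i at hy
  obtain ⟨z, hz⟩ := hlat (Fin.last _)
  obtain ⟨i₀, hi₀⟩ := Finite.exists_min y
  obtain ⟨a, ha⟩ : ∃ a : Fin D → ℕ, ∀ i, y i = y i₀ + a i :=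
    ⟨fun i => (y i - y i₀).toNat, fun i => by have := hi₀ i; simp only; omega⟩
  obtain ⟨t, c, h0, h1, h2, h3, h4, h5, h6, h7, h8⟩ := hx
  have hc : c ≤ y i₀ := hy i₀ ▸ h0 i₀
  have hsum : ∑ i, midCoord x i = D * (y i₀ : ℝ) + (∑ i, a i : ℕ) := by
    have hya : ∀ i, midCoord x i = y i₀ + a i := fun i => by rw [hy, ha]; push_cast; rfl
    simp [hya, Finset.sum_add_distrib]
  rw [hx0] at h2
  rw [hsum, hx0] at h4
  rw [hx0, hz] at h5
  rw [hsum, hx0, hz] at h6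
  rw [hsum, hx0, hz] at h7
  rw [hx0, hz] at h8
  push_cast only [Nat.cast_add] at h4 h6 h7 h8
  set s := ∑ i, a i with hs
  have hh' : (1 : ℝ) ≤ h := by exact_mod_cast hh
  have hD' : (1 : ℝ) ≤ D := by exact_mod_cast hD
  -- the inequalities persist when `c` is increased to the minimal middle coordinate
  have e1 : 0 ≤ (D - 1) * ((y i₀ : ℝ) - c) := mul_nonneg (by linarith) (by linarith)
  have e2 : 0 ≤ (h - 1) * (D * ((y i₀ : ℝ) - c)) :=
    mul_nonneg (by linarith) (mul_nonneg (by linarith) (by linarith))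
  have k4 : (y i₀ : ℝ) - h * (N - s) ≤ t := by linarith
  have k3 : t ≤ (y i₀ : ℝ) := h3.trans hc
  have hsN : s ≤ N := by
    have : 0 ≤ (h : ℝ) * (N - s) := by linarith
    have := nonneg_of_mul_nonneg_right this (by linarith)
    exact_mod_cast (by linarith : (s : ℝ) ≤ N)
  obtain ⟨M, rfl⟩ := Nat.exists_eq_add_of_le hsN
  push_cast at h4 h6 h7 h8 k4
  obtain ⟨l, p, q, σ, τ, hl, hσ, hτ, hp, hq, hpq, hqp, hcl, hzl⟩ :=
    exists_decomposition_parameters (G := h * M) (M := M) (k := k) (s := s) (c := y i₀) (z := z)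
      (t := t) hn (by exact_mod_cast Nat.le_mul_of_pos_left M hh) (by rintro rfl; simp) h1 h2 k3
      (by push_cast; linarith) h5 (by linarith) (by push_cast; linarith) (by linarith)
  obtain ⟨f, hf, f0, fm, fl⟩ := exists_sum_facet hh a hτ (by exact_mod_cast hp)
    (by exact_mod_cast hq) hpq hqp
  obtain ⟨g, hg, g0, gm, gl⟩ := exists_sum_top h (D := D) hl hσ
  refine ⟨f, g, hf, hg, ext_coord ?_ (fun i => ?_) ?_⟩
  · rw [Pi.add_apply, f0, g0, hx0, zero_add]
  · rw [midCoord_add, fm, gm, hy, ha, hcl]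
    push_cast
    ring
  · rw [Pi.add_apply, fl, gl, hz, hzl]
    push_cast
    ring

theorem P1_subset_poly (h d : ℕ) : P1 h d ⊆ poly h d := by
  refine convexHull_min ?_ (convex_poly h d)
  rintro _ (rfl | rfl | rfl | rfl) <;> exact u_mem_poly (by simp) (by simp)

theorem isKNormal_poly {h D : ℕ} (hh : 1 ≤ h) (hD : 1 ≤ D) :
    IsKNormal 3 (poly h (D + 2)) := by
  intro n hn x hx hlat
  have hb := sliceBound_of_mem_dilate hh hx
  obtain ⟨m, hm⟩ := hlat 0
  have hm0 : 0 ≤ x 0 ∧ x 0 ≤ n := by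
    obtain ⟨t, c, h0, h1, h2, h3, h4, -⟩ := hb
    refine ⟨h1.trans h2, ?_⟩
    -- Both `s` and `M` are nonnegative, the latter from `h M ≥ c - t ≥ 0`, so `n - x 0 = s + M ≥
    -- 0`.
    have hs : D * c ≤ ∑ i, midCoord x i := by
      simpa using Finset.sum_le_sum fun i (_ : i ∈ univ) => h0 i
    have hh' : (0 : ℝ) < h := by exact_mod_cast hh
    have := nonneg_of_mul_nonneg_right
      (by linarith : 0 ≤ (h : ℝ) * (n - x 0 - (∑ i, midCoord x i - D * c))) hh'
    linarith
  rw [hm] at hm0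
  obtain ⟨k, rfl⟩ := Int.eq_ofNat_of_zero_le (by exact_mod_cast hm0.1 : 0 ≤ m)
  obtain ⟨N, rfl⟩ := Nat.exists_eq_add_of_le' (by exact_mod_cast hm0.2 : k ≤ n)
  obtain ⟨a, b, ha, hb', rfl⟩ := exists_slice_decomposition hh hD hn hb (by simpa using hm) hlat
  refine ⟨Fin.append a b, fun j => ?_, by simp [Fin.sum_univ_add]⟩
  refine Fin.addCases (fun j => ?_) (fun j => ?_) j
  · rw [Fin.append_left]
    exact ⟨(ha j).1.1, (ha j).2⟩
  · rw [Fin.append_right]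
    exact ⟨P1_subset_poly h _ (hb' j).1, (hb' j).2⟩

/-! ### Holes of `k`-normal convex sets -/

section Holes

variable {N : ℕ} {P : Set (Fin N → ℝ)}

theorem homogenization_subset (hP : Convex ℝ P) :
    homogenization P ⊆ {x | Fin.init x ∈ P ∧ x (Fin.last N) = 1} := by
  refine convexHull_min ?_ ?_
  · rintro _ ⟨α, hα, rfl⟩
    simpa using hα
  · rintro x ⟨hx, hx1⟩ y ⟨hy, hy1⟩ a b ha hb hab
    exact ⟨hP hx hy ha hb hab, by simp [hx1, hy1, hab]⟩

theorem snoc_mem_latticeGens {α : Fin N → ℝ} (hα : α ∈ P) (hlat : IsLatticePoint α) :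
    (Fin.snoc α (1 : ℝ) : Fin (N + 1) → ℝ) ∈ latticeGens P := by
  refine ⟨subset_convexHull ℝ _ ⟨α, hα, rfl⟩, fun i => ?_⟩
  refine Fin.lastCases ⟨1, by simp⟩ (fun i => ?_) i
  simpa using hlat i

theorem init_mem_smul_of_mem_span (hP : Convex ℝ P) (hne : P.Nonempty) {x : Fin (N + 1) → ℝ}
    (hx : x ∈ Submodule.span NNReal (latticeGens P)) :
    0 ≤ x (Fin.last N) ∧ ∃ p ∈ P, Fin.init x = x (Fin.last N) • p := by
  induction hx using Submodule.span_induction with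
  | mem x hx =>
    obtain ⟨h1, h2⟩ := homogenization_subset hP hx.1
    exact ⟨by rw [h2]; exact zero_le_one, _, h1, by rw [h2, one_smul]⟩
  | zero =>
    obtain ⟨p, hp⟩ := hne
    refine ⟨le_rfl, p, hp, ?_⟩
    rw [Pi.zero_apply, zero_smul]
    rfl
  | add x y _ _ hx hy =>
    obtain ⟨hx, p, hp, hxp⟩ := hx
    obtain ⟨hy, q, hq, hyq⟩ := hy
    -- For convex `P` and `a, b ≥ 0`, `(a + b) P = a P + b P`.
    obtain ⟨r, hr, hr'⟩ : ((x (Fin.last N) + y (Fin.last N)) • P) (Fin.init x + Fin.init y) := by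
      rw [hP.add_smul hx hy, hxp, hyq]
      exact Set.add_mem_add (Set.smul_mem_smul_set hp) (Set.smul_mem_smul_set hq)
    exact ⟨add_nonneg hx hy, r, hr, hr'.symm⟩
  | smul c x _ hx =>
    obtain ⟨hx, p, hp, hxp⟩ := hx
    refine ⟨mul_nonneg c.2 hx, p, hp, ?_⟩
    change (c : ℝ) • Fin.init x = ((c : ℝ) • x (Fin.last N)) • p
    rw [hxp, smul_assoc]

theorem isLatticePoint_of_mem_closure {x : Fin (N + 1) → ℝ}
    (hx : x ∈ AddSubgroup.closure (latticeGens P)) : IsLatticePoint x := by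
  induction hx using AddSubgroup.closure_induction with
  | mem x hx => exact hx.2
  | zero => exact isLatticePoint_zero
  | add x y _ _ hx hy => exact hx.add hy
  | neg x _ hx => exact hx.neg

theorem IsKNormal.degree_lt_of_mem_holes {k : ℕ} (hk : IsKNormal k P) (hP : Convex ℝ P)
    (hne : P.Nonempty) {x : Fin (N + 1) → ℝ} (hx : x ∈ holes P) : x (Fin.last N) < k := by
  by_contra! hkx
  obtain ⟨hspan, hgrp, hmon⟩ := hx
  obtain ⟨h0, p, hp, hxp⟩ := init_mem_smul_of_mem_span hP hne hspan
  have hlat := isLatticePoint_of_mem_closure hgrp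
  obtain ⟨m, hm⟩ := hlat (Fin.last N)
  rw [hm] at h0 hkx hxp
  obtain ⟨n, rfl⟩ := Int.eq_ofNat_of_zero_le (by exact_mod_cast h0 : 0 ≤ m)
  obtain ⟨a, ha, hsum⟩ := hk n (by exact_mod_cast hkx) (Fin.init x)
    ⟨p, hp, by simpa using hxp.symm⟩ fun i => hlat i.castSucc
  refine hmon ?_
  have : x = ∑ s, (Fin.snoc (a s) (1 : ℝ) : Fin (N + 1) → ℝ) := by
    funext i
    refine Fin.lastCases ?_ (fun i => ?_) i
    · simp [hm]
    · have := congrFun hsum i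
      simpa [Fin.init] using this
  rw [this]
  exact sum_mem fun s _ => AddSubmonoid.subset_closure (snoc_mem_latticeGens (ha s).1 (ha s).2)

end Holes

end HolePolytope

theorem mainTheorem4 (h d : ℕ) (hh : 1 ≤ h) (hd : 3 ≤ d) :
    (∀ n k : ℕ, 3 ≤ n → k ≤ n →
      ∀ α ∈ HolePolytope.slice h d n k, HolePolytope.IsLatticePoint α →
        ∃ (a : Fin (n - k) → (Fin d → ℝ)) (b : Fin k → (Fin d → ℝ)),
          (∀ s, a s ∈ HolePolytope.F0 h d ∧ HolePolytope.IsLatticePoint (a s)) ∧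
          (∀ t, b t ∈ HolePolytope.P1 h d ∧ HolePolytope.IsLatticePoint (b t)) ∧
          α = (∑ s, a s) + (∑ t, b t)) ∧
    HolePolytope.IsKNormal 3 (HolePolytope.poly h d) ∧
    (∀ x ∈ HolePolytope.holes (HolePolytope.poly h d), ¬ (3 ≤ x (Fin.last d))) := by
  obtain ⟨D, rfl⟩ := Nat.exists_eq_add_of_le' (by omega : 2 ≤ d)
  have hD : 1 ≤ D := by omega
  have hnormal := HolePolytope.isKNormal_poly hh hD
  refine ⟨fun n k hn hk x hx hlat => ?_, hnormal, fun x hx => not_le.2 ?_⟩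
  · refine HolePolytope.exists_slice_decomposition hh hD (by omega) ?_ (hx.2 0 rfl) hlat
    rw [Nat.sub_add_cancel hk]
    exact HolePolytope.sliceBound_of_mem_dilate hh hx.1
  · simpa using hnormal.degree_lt_of_mem_holes (HolePolytope.convex_poly _ _)
      ⟨_, HolePolytope.u_mem_poly (i := 1) le_rfl (by simp)⟩ hx
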